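/- Let $c>0$ and, for $k\in\mathbb{N}$, let $\mathbb{D}^k_c=\{x\in\mathbb{R}^k : c\|x\|^2<1\}$, with the topology induced by the hyperbolic metric $$ d_c(x,y)=\frac{2}{\sqrt c}\tanh^{-1}\!\left(\sqrt c\,\left\|\frac{(1-c\|x\|^2)\,y-(1-2c\,x^{\top}y+c\|y\|^2)\,x}{1-2c\,x^{\top}y+c^2\|x\|^2\|y\|^2}\right\|\right), $$ which is the distance of the Riemannian metric $g_x=\left(\frac{2}{1-c\|x\|^2}\right)^2 I_k$ on $\mathbb{D}^k_c$. Let $\operatorname{Exp}^{\mathbb{D}^k_c}_0:\mathbb{R}^k\to\mathbb{D}^k_c$ be the Riemannian exponential map at $0$ of this metric (it sends $v$ to the point reached at time $1$ by the geodesic with initial point $0$ and initial velocity $v$), and let $\operatorname{Log}^{\mathbb{D}^k_c}_0$ be its inverse. Let $\sigma:\mathbb{R}\to\mathbb{R}$ be continuous, locally bounded and non-polynomial, and let $\mathcal{NN}$ be the set of feed-forward networks $f=W\circ f^{(J)}:\mathbb{R}^m\to\mathbb{R}^n$, where $J\ge 1$, $f^{(0)}(x)=x$, $f^{(j)}(x)=\sigma\bullet\big(W^{(j)}\circ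 f^{(j-1)}(x)\big)$ for $j=1,\dots,J$, the maps $W,W^{(1)},\dots,W^{(J)}$ are affine (between Euclidean spaces of arbitrary matching dimensions) and $\sigma\bullet$ denotes componentwise application of $\sigma$. Then for every continuous $g:\mathbb{D}^m_c\to\mathbb{D}^n_c$, every $\epsilon>0$ and every compact $K\subseteq\mathbb{D}^m_c$ there is $f\in\mathcal{NN}$ such that the hyperbolic feed-forward network $h=\operatorname{Exp}^{\mathbb{D}^n_c}_0\circ f\circ\operatorname{Log}^{\mathbb{D}^m_c}_0$ is continuous and satisfies $$ \sup_{x\in K} d_c\big(g(x),h(x)\big)<\epsilon . $$ -/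

import Mathlib

open scoped Topology

noncomputable section

/-- The underlying set `{x ∈ ℝⁿ : c ‖x‖² < 1}` of the generalized hyperbolic space `𝔻ⁿ_c`.
This is a `def` so that it does not inherit the Euclidean subspace topology: its topology is
the one of the hyperbolic metric, given below. -/
def PoincareBall (c : ℝ) (n : ℕ) : Type :=
  {x : EuclideanSpace ℝ (Fin n) // c * ‖x‖ ^ 2 < 1}

namespace PoincareBall

variable {c : ℝ} {m n : ℕ}

/-- The point of `ℝⁿ` underlying a point of the ball. -/
def val (x : PoincareBall c n) : EuclideanSpace ℝ (Fin n) := Subtype.val x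

/-- The centre `0` of the ball. -/
def origin (c : ℝ) (n : ℕ) : PoincareBall c n := ⟨0, by simp⟩

instance : Nonempty (PoincareBall c n) := ⟨origin c n⟩

/-- The hyperbolic metric
`d_c(x, y) = (2/√c) artanh (√c ‖((1 - c‖x‖²) y - (1 - 2c x·y + c‖y‖²) x)
  / (1 - 2c x·y + c²‖x‖²‖y‖²)‖)`. -/
def hdist (x y : PoincareBall c n) : ℝ :=
  2 / √c * Real.artanh (√c *
    ‖(1 - 2 * c * inner ℝ x.val y.val + c ^ 2 * ‖x.val‖ ^ 2 * ‖y.val‖ ^ 2)⁻¹ •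
      ((1 - c * ‖x.val‖ ^ 2) • y.val
        - (1 - 2 * c * inner ℝ x.val y.val + c * ‖y.val‖ ^ 2) • x.val)‖)

/-- The topology induced by `d_c`: the smallest one containing all open balls of `d_c`. -/
instance : TopologicalSpace (PoincareBall c n) :=
  TopologicalSpace.generateFrom
    {B | ∃ (y : PoincareBall c n) (ε : ℝ), 0 < ε ∧ B = {z | hdist z y < ε}}

end PoincareBall

/-- Christoffel symbol `Γᵏᵢⱼ(x) = ½ ∑ₗ gᵏˡ (∂ᵢ gⱼₗ + ∂ⱼ gᵢₗ - ∂ₗ gᵢⱼ)` of a Riemannian metric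
`g` given in a chart of `ℝⁿ`. -/
def christoffel {n : ℕ} (g : EuclideanSpace ℝ (Fin n) → Matrix (Fin n) (Fin n) ℝ)
    (k i j : Fin n) (x : EuclideanSpace ℝ (Fin n)) : ℝ :=
  1 / 2 * ∑ l, (g x)⁻¹ k l *
    (fderiv ℝ (fun z => g z j l) x (EuclideanSpace.single i 1)
      + fderiv ℝ (fun z => g z i l) x (EuclideanSpace.single j 1)
      - fderiv ℝ (fun z => g z i j) x (EuclideanSpace.single l 1))

/-- The Riemannian metric tensor of `𝔻ⁿ_c`, conformal to the Euclidean one: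
`g_x = λ(x)² I` with `λ(x) = 2 / (1 - c‖x‖²)`. -/
def poincareMetric (c : ℝ) (n : ℕ) (x : EuclideanSpace ℝ (Fin n)) :
    Matrix (Fin n) (Fin n) ℝ :=
  (2 / (1 - c * ‖x‖ ^ 2)) ^ 2 • (1 : Matrix (Fin n) (Fin n) ℝ)

namespace PoincareBall

variable {c : ℝ} {m n : ℕ}

/-- `γ : [0, 1] → 𝔻ⁿ_c` is a geodesic with velocity `γ'`, i.e. it solves the geodesic equation
`γₖ'' + ∑ᵢⱼ Γᵏᵢⱼ(γ) γᵢ' γⱼ' = 0` of the metric of `𝔻ⁿ_c` (values outside `[0, 1]` play no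
role). -/
structure IsGeodesic (c : ℝ) {n : ℕ} (γ γ' : ℝ → EuclideanSpace ℝ (Fin n)) : Prop where
  mem_ball : ∀ t ∈ Set.Icc (0 : ℝ) 1, c * ‖γ t‖ ^ 2 < 1
  velocity : ∀ t ∈ Set.Icc (0 : ℝ) 1, HasDerivWithinAt γ (γ' t) (Set.Icc 0 1) t
  acceleration : ∀ t ∈ Set.Icc (0 : ℝ) 1,
    HasDerivWithinAt γ'
      (WithLp.toLp 2 fun k =>
        -∑ i, ∑ j, christoffel (poincareMetric c n) k i j (γ t) * γ' t i * γ' t j)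
      (Set.Icc 0 1) t

/-- `y` is reached at time `1` by a geodesic which starts at `p` with initial velocity `v`. -/
def ReachedByGeodesic (p : PoincareBall c n) (v : EuclideanSpace ℝ (Fin n))
    (y : PoincareBall c n) : Prop :=
  ∃ γ γ' : ℝ → EuclideanSpace ℝ (Fin n),
    IsGeodesic c γ γ' ∧ γ 0 = p.val ∧ γ' 0 = v ∧ γ 1 = y.val

/-- The Riemannian exponential map at `p`: it sends a tangent vector `v ∈ T_p 𝔻ⁿ_c = ℝⁿ` to the
point reached at time `1` by the geodesic with initial point `p` and initial velocity `v`. -/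
def Exp (p : PoincareBall c n) (v : EuclideanSpace ℝ (Fin n)) : PoincareBall c n :=
  Classical.epsilon (ReachedByGeodesic p v)

/-- The Riemannian logarithm at `p`, the inverse of the exponential map at `p`. -/
def Log (p : PoincareBall c n) : PoincareBall c n → EuclideanSpace ℝ (Fin n) :=
  Function.invFun (Exp p)

end PoincareBall

/-- `IsHiddenLayer σ m J k f`: the map `f : ℝᵐ → ℝᵏ` is the `J`-th hidden layer `f^{(J)}` of a
feed-forward network: `f^{(0)} = id` and `f^{(J)} = σ • (W^{(J)} ∘ f^{(J-1)})` with `W^{(J)}`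
affine and `σ •` acting on each component. -/
inductive IsHiddenLayer (σ : ℝ → ℝ) (m : ℕ) :
    ℕ → (k : ℕ) → (EuclideanSpace ℝ (Fin m) → EuclideanSpace ℝ (Fin k)) → Prop
  | input : IsHiddenLayer σ m 0 m (fun x => x)
  | layer {J k l : ℕ} {f : EuclideanSpace ℝ (Fin m) → EuclideanSpace ℝ (Fin k)}
      (hf : IsHiddenLayer σ m J k f)
      (W : EuclideanSpace ℝ (Fin k) →ᵃ[ℝ] EuclideanSpace ℝ (Fin l)) :
      IsHiddenLayer σ m (J + 1) l (fun x => WithLp.toLp 2 fun i => σ (W (f x) i))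

/-- The feed-forward networks `W ∘ f^{(J)}` from `ℝᵐ` to `ℝⁿ` with activation function `σ`, with
any number `J ≥ 1` of hidden layers of any widths. -/
def FeedForward (σ : ℝ → ℝ) (m n : ℕ) :
    Set (EuclideanSpace ℝ (Fin m) → EuclideanSpace ℝ (Fin n)) :=
  {F | ∃ (J k : ℕ) (f : EuclideanSpace ℝ (Fin m) → EuclideanSpace ℝ (Fin k))
      (W : EuclideanSpace ℝ (Fin k) →ᵃ[ℝ] EuclideanSpace ℝ (Fin n)),
      1 ≤ J ∧ IsHiddenLayer σ m J k f ∧ F = fun x => W (f x)}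

/-- The hyperbolic feed-forward networks `Exp₀ ∘ f ∘ Log₀ ∈ C(𝔻ᵐ_c, 𝔻ⁿ_c)`, `f` a feed-forward
network from `ℝᵐ` to `ℝⁿ`. -/
def HyperbolicFeedForward (σ : ℝ → ℝ) (c : ℝ) (m n : ℕ) :
    Set C(PoincareBall c m, PoincareBall c n) :=
  {h | ∃ f ∈ FeedForward σ m n, ∀ x,
    h x = (PoincareBall.origin c n).Exp (f ((PoincareBall.origin c m).Log x))}

/-- `σ` is bounded on some neighbourhood of each point. -/
def LocallyBoundedFun (σ : ℝ → ℝ) : Prop :=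
  ∀ t : ℝ, ∃ U ∈ 𝓝 t, ∃ M : ℝ, ∀ s ∈ U, |σ s| ≤ M

/-- `σ` is given by a real polynomial. -/
def IsPolynomialFun (σ : ℝ → ℝ) : Prop :=
  ∃ p : Polynomial ℝ, ∀ t : ℝ, σ t = p.eval t

end

noncomputable section

/-! ### Density of ridge functions in C(X, ℝ) -/

section UniversalApproximation

open MeasureTheory Polynomial ContDiff

/-! `Exp₀` and `Log₀` are mutually inverse homeomorphisms, so `Log₀ ∘ g ∘ Exp₀` is a continuous map
of Euclidean spaces. A network approximates it uniformly on the compact set `Log₀(K)`, and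
continuity of `Exp₀`, uniform near a compact set, turns Euclidean closeness into closeness for
`d_c`.

Approximation (`closure_span_ridge_eq_top`): let `W` be the closed span of the functions `σ(l + b)`.
Mollifying `σ` to a smooth `f` stays inside `W`, and `k` derivatives of `f(w l + b)` in `w` at `w =
0` give `f⁽ᵏ⁾(b) lᵏ`. If `f⁽ᵏ⁾` vanished for every mollifier, `σ` would be a limit of polynomials of
degree below `k`, hence a polynomial. So `W` contains every `lᵏ`, thus every `exp l`; these are
closed under products, and Stone–Weierstrass applies to their span.

Geometry: a tanh-parametrised segment solves the geodesic equation, and ODE uniqueness makes it the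
only solution (`reachedByGeodesic_origin_iff`). Hence `Exp₀` and `Log₀` are radial, with profiles
tanh and artanh. The identity `hdenom_mul_norm_mobiusDiff_sq` compares `d_c` with the Euclidean
distance, so both induce the same topology. -/

theorem Submodule.integral_mem_of_isClosed {α E : Type*} [MeasurableSpace α] {μ : Measure α}
    [NormedAddCommGroup E] [NormedSpace ℝ E] [CompleteSpace E] (W : Submodule ℝ E)
    (hW : IsClosed (W : Set E)) {F : α → E} (hF : ∀ t, F t ∈ W) : ∫ t, F t ∂μ ∈ W := by
  have : CompleteSpace W := hW.completeSpace_coe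
  -- An isometric inclusion commutes with the integral even when `F` is not integrable.
  have h := W.subtypeₗᵢ.integral_comp_comm (μ := μ) (fun t => (⟨F t, hF t⟩ : W))
  exact h ▸ Subtype.mem _

theorem HasDerivAt.mem_of_forall_mem {E : Type*} [NormedAddCommGroup E] [NormedSpace ℝ E]
    (W : Submodule ℝ E) (hW : IsClosed (W : Set E)) {F : ℝ → E} {F' : E} {t : ℝ}
    (h : HasDerivAt F F' t) (hF : ∀ s, F s ∈ W) : F' ∈ W := by
  refine hW.mem_of_tendsto h.tendsto_slope (Filter.Eventually.of_forall fun s => ?_)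
  exact W.smul_mem _ (W.sub_mem (hF s) (hF t))

/-- Pointwise, `F` is the integral of `F'`; continuity of `F'` in sup norm makes this an identity in
C(X, ℝ), where the fundamental theorem of calculus applies. -/
theorem ContinuousMap.hasDerivAt_of_eval {X : Type*} [TopologicalSpace X] [CompactSpace X]
    {F F' : ℝ → C(X, ℝ)} (hF' : Continuous F')
    (h : ∀ t x, HasDerivAt (fun s => F s x) (F' t x) t) (t : ℝ) : HasDerivAt F (F' t) t := by
  have key : F = fun s => F 0 + ∫ u in (0 : ℝ)..s, F' u := by
    funext s
    ext x
    have h1 := (ContinuousMap.evalCLM ℝ x).intervalIntegral_comp_comm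
      (hF'.intervalIntegrable (μ := volume) 0 s)
    have h2 := intervalIntegral.integral_eq_sub_of_hasDerivAt (fun u _ => h u x)
      (((ContinuousMap.evalCLM ℝ x).continuous.comp hF').intervalIntegrable (μ := volume) 0 s)
    simp only [ContinuousMap.evalCLM_apply] at h1
    rw [ContinuousMap.add_apply, ← h1, h2]
    ring
  rw [key]
  exact (intervalIntegral.integral_hasDerivAt_right (hF'.intervalIntegrable _ _)
    hF'.stronglyMeasurable.stronglyMeasurableAtFilter hF'.continuousAt).const_add (F 0)

/-- The function `x ↦ f (w * l x + b)`. -/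
def ridge {X : Type*} [TopologicalSpace X] (f : C(ℝ, ℝ)) (l : C(X, ℝ)) (w b : ℝ) : C(X, ℝ) :=
  f.comp (w • l + ContinuousMap.const X b)

section

variable {X : Type*} [TopologicalSpace X]

@[simp]
theorem ridge_apply (f : C(ℝ, ℝ)) (l : C(X, ℝ)) (w b : ℝ) (x : X) :
    ridge f l w b x = f (w * l x + b) := rfl

theorem continuous_ridge [CompactSpace X] (f : C(ℝ, ℝ)) (l : C(X, ℝ)) :
    Continuous fun p : ℝ × ℝ => ridge f l p.1 p.2 := by
  refine ContinuousMap.continuous_of_continuous_uncurry _ ?_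
  simp only [Function.uncurry_def, ridge_apply]
  fun_prop

/-- The convolution is an integral of shifts `φ t • σ(w l + b - t)`, each lying in `W`. -/
theorem ridge_convolution_mem [CompactSpace X] (W : Submodule ℝ C(X, ℝ))
    (hW : IsClosed (W : Set C(X, ℝ))) (σ : C(ℝ, ℝ)) (l : C(X, ℝ))
    (hσ : ∀ w b, ridge σ l w b ∈ W) {φ : ℝ → ℝ} (hφ : Continuous φ) (hφc : HasCompactSupport φ)
    (f : C(ℝ, ℝ)) (hf : ∀ x, f x = convolution φ σ (ContinuousLinearMap.lsmul ℝ ℝ) volume x)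
    (w b : ℝ) : ridge f l w b ∈ W := by
  have hc : Continuous fun t => φ t • ridge σ l w (b - t) :=
    hφ.smul ((continuous_ridge σ l).comp (by fun_prop : Continuous fun t : ℝ => (w, b - t)))
  have hi : Integrable (fun t => φ t • ridge σ l w (b - t)) :=
    hc.integrable_of_hasCompactSupport hφc.smul_right
  have : ridge f l w b = ∫ t, φ t • ridge σ l w (b - t) := by
    ext x
    have h1 := (ContinuousMap.evalCLM ℝ x).integral_comp_comm hi
    simp only [ContinuousMap.evalCLM_apply] at h1
    rw [← h1, ridge_apply, hf, convolution_def]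
    refine integral_congr_ae (Filter.Eventually.of_forall fun t => ?_)
    simp [add_sub_assoc]
  rw [this]
  exact Submodule.integral_mem_of_isClosed W hW fun t => W.smul_mem _ (hσ _ _)

/-- Each derivative in `w` brings down one factor `l` and differentiates `f` once. -/
theorem pow_mul_ridge_iteratedDeriv_mem [CompactSpace X] (W : Submodule ℝ C(X, ℝ))
    (hW : IsClosed (W : Set C(X, ℝ))) (l : C(X, ℝ)) (f : ℝ → ℝ) (hf : ContDiff ℝ ∞ f)
    (h : ∀ w b, ridge ⟨f, hf.continuous⟩ l w b ∈ W) (k : ℕ) (w b : ℝ) :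
    l ^ k * ridge ⟨iteratedDeriv k f, hf.continuous_iteratedDeriv k (mod_cast le_top)⟩ l w b
      ∈ W := by
  induction k generalizing w with
  | zero => simpa [iteratedDeriv_zero] using h w b
  | succ k ih =>
    refine HasDerivAt.mem_of_forall_mem W hW (t := w)
      (ContinuousMap.hasDerivAt_of_eval (F' := fun w => l ^ (k + 1) * ridge ⟨iteratedDeriv (k + 1) f,
        hf.continuous_iteratedDeriv (k + 1) (mod_cast le_top)⟩ l w b) ?_ ?_ w) ih
    · exact continuous_const.mul
        ((continuous_ridge _ l).comp (by fun_prop : Continuous fun t : ℝ => (t, b)))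
    · intro t x
      have hd : HasDerivAt (iteratedDeriv k f) (iteratedDeriv (k + 1) f (t * l x + b))
          (t * l x + b) := by
        rw [iteratedDeriv_succ]
        exact (hf.differentiable_iteratedDeriv k
          (mod_cast WithTop.coe_lt_top k) _).hasDerivAt
      have hd' : HasDerivAt (fun s : ℝ => l x ^ k * iteratedDeriv k f (s * l x + b))
          (l x ^ k * (iteratedDeriv (k + 1) f (t * l x + b) * (1 * l x))) t :=
        (hd.comp t (((hasDerivAt_id t).mul_const (l x)).add_const b)).const_mul (l x ^ k)
      have he : l x ^ k * (iteratedDeriv (k + 1) f (t * l x + b) * (1 * l x))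
          = l x ^ (k + 1) * iteratedDeriv (k + 1) f (t * l x + b) := by ring
      rw [he] at hd'
      exact hd'

end

theorem exists_polynomial_of_iteratedDeriv_eq_zero (k : ℕ) (f : ℝ → ℝ) (hf : ContDiff ℝ ∞ f)
    (h : ∀ x, iteratedDeriv k f x = 0) : ∃ p ∈ degreeLT ℝ k, ∀ x, f x = p.eval x := by
  induction k generalizing f with
  | zero => exact ⟨0, Submodule.zero_mem _, fun x => by simpa using h x⟩
  | succ k ih =>
    obtain ⟨p, hp, hpe⟩ := ih (deriv f) ((contDiff_infty_iff_deriv.1 hf).2)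
      (fun x => by simpa [iteratedDeriv_succ'] using h x)
    let q : ℝ[X] := ∑ i ∈ Finset.range k, C (p.coeff i / (i + 1)) * X ^ (i + 1)
    have hq : derivative q = p := by
      ext j
      simp only [q, coeff_derivative, finsetSum_coeff, coeff_C_mul, coeff_X_pow,
        add_left_inj, mul_ite, mul_one, mul_zero, Finset.sum_ite_eq, Finset.mem_range]
      split_ifs with hj
      · field_simp
      · rw [zero_mul, coeff_eq_zero_of_degree_lt]
        exact (mem_degreeLT.1 hp).trans_le (by exact_mod_cast not_lt.1 hj)
    have hconst := is_const_of_deriv_eq_zero (f := fun x => f x - q.eval x)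
      ((hf.differentiable (by simp)).sub q.differentiable) (fun x => by
        rw [deriv_fun_sub (hf.differentiable (by simp) x) q.differentiableAt, q.deriv, hq, hpe]
        simp)
    refine ⟨q + C (f 0 - q.eval 0), Submodule.add_mem _ (Submodule.sum_mem _ fun i hi => ?_) ?_,
      fun x => ?_⟩
    · rw [mem_degreeLT]
      refine (degree_C_mul_X_pow_le _ _).trans_lt ?_
      exact_mod_cast Nat.succ_lt_succ (Finset.mem_range.1 hi)
    · rw [mem_degreeLT]
      exact degree_C_le.trans_lt (by exact_mod_cast k.succ_pos)
    · have := hconst x 0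
      simp only [eval_add, eval_C]
      linarith

/-- Polynomials of bounded degree form a finite-dimensional space, closed even under pointwise
convergence. -/
theorem exists_polynomial_of_tendsto (k : ℕ) {F : ℕ → ℝ → ℝ} {f : ℝ → ℝ}
    (hF : ∀ i, ∃ p ∈ degreeLT ℝ k, ∀ x, F i x = p.eval x)
    (h : ∀ x, Filter.Tendsto (fun i => F i x) Filter.atTop (𝓝 (f x))) :
    ∃ p ∈ degreeLT ℝ k, ∀ x, f x = p.eval x := by
  let ev : ℝ[X] →ₗ[ℝ] ℝ → ℝ := LinearMap.pi fun x => Polynomial.leval x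
  have : FiniteDimensional ℝ (degreeLT ℝ k) := (degreeLTEquiv ℝ k).symm.finiteDimensional
  have hcl : IsClosed (((degreeLT ℝ k).map ev : Submodule ℝ (ℝ → ℝ)) : Set (ℝ → ℝ)) :=
    Submodule.closed_of_finiteDimensional _
  have hmem : f ∈ (degreeLT ℝ k).map ev := by
    refine hcl.mem_of_tendsto (tendsto_pi_nhds.2 h) (Filter.Eventually.of_forall fun i => ?_)
    obtain ⟨p, hp, hpe⟩ := hF i
    exact ⟨p, hp, funext fun x => (hpe x).symm⟩
  obtain ⟨p, hp, rfl⟩ := hmem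
  exact ⟨p, hp, fun x => rfl⟩

theorem exists_convolution_iteratedDeriv_ne_zero {σ : ℝ → ℝ} (hσ : Continuous σ)
    (hpoly : ¬ IsPolynomialFun σ) (k : ℕ) :
    ∃ φ : ContDiffBump (0 : ℝ), ∃ b : ℝ, iteratedDeriv k
      (convolution (φ.normed volume) σ (ContinuousLinearMap.lsmul ℝ ℝ) volume) b ≠ 0 := by
  by_contra! hcon
  let φ : ℕ → ContDiffBump (0 : ℝ) := fun i =>
    ⟨1 / ((i : ℝ) + 1) / 2, 1 / ((i : ℝ) + 1), by positivity, half_lt_self (by positivity)⟩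
  obtain ⟨p, -, hp⟩ := exists_polynomial_of_tendsto k
    (fun i => exists_polynomial_of_iteratedDeriv_eq_zero k _
      ((φ i).hasCompactSupport_normed.contDiff_convolution_left _
        (φ i).contDiff_normed hσ.locallyIntegrable) (hcon (φ i)))
    (fun x => ContDiffBump.convolution_tendsto_right_of_continuous
      (tendsto_one_div_add_atTop_nhds_zero_nat (𝕜 := ℝ)) hσ x)
  exact hpoly ⟨p, hp⟩

theorem pow_mem_of_ridge_mem {X : Type*} [TopologicalSpace X] [CompactSpace X]
    (W : Submodule ℝ C(X, ℝ)) (hW : IsClosed (W : Set C(X, ℝ))) (σ : C(ℝ, ℝ))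
    (hpoly : ¬ IsPolynomialFun σ) (l : C(X, ℝ)) (hσ : ∀ w b, ridge σ l w b ∈ W) (k : ℕ) :
    l ^ k ∈ W := by
  obtain ⟨φ, b, hb⟩ := exists_convolution_iteratedDeriv_ne_zero σ.continuous hpoly k
  have hf : ContDiff ℝ ∞ (convolution (φ.normed volume) σ (ContinuousLinearMap.lsmul ℝ ℝ) volume) :=
    φ.hasCompactSupport_normed.contDiff_convolution_left _ φ.contDiff_normed
      σ.continuous.locallyIntegrable
  have := pow_mul_ridge_iteratedDeriv_mem W hW l _ hf (fun w b => ridge_convolution_mem W hW σ l hσ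
    φ.continuous_normed φ.hasCompactSupport_normed _ (fun x => rfl) w b) k 0 b
  refine (W.smul_mem_iff hb).1 ?_
  convert this using 1
  ext x
  simp [mul_comm]

theorem exp_mem_of_pow_mem {A : Type*} [NormedCommRing A] [NormedAlgebra ℝ A] [CompleteSpace A]
    (W : Submodule ℝ A) (hW : IsClosed (W : Set A)) (a : A) (h : ∀ k : ℕ, a ^ k ∈ W) :
    NormedSpace.exp a ∈ W := by
  refine hW.mem_of_tendsto (NormedSpace.exp_series_hasSum_exp' (𝕂 := ℝ) a)
    (Filter.Eventually.of_forall fun s => W.sum_mem fun k _ => W.smul_mem _ (h k))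

/-- Ridge functions built from a continuous non-polynomial `σ` and a point-separating space `L` of
continuous functions span a dense subspace. -/
theorem closure_span_ridge_eq_top {X : Type*} [TopologicalSpace X] [CompactSpace X] (σ : C(ℝ, ℝ))
    (hpoly : ¬ IsPolynomialFun σ) (L : Submodule ℝ C(X, ℝ))
    (hL : ∀ x y, x ≠ y → ∃ l ∈ L, l x ≠ l y) :
    (Submodule.span ℝ {f | ∃ l ∈ L, ∃ b, f = ridge σ l 1 b}).topologicalClosure = ⊤ := by
  set W := (Submodule.span ℝ {f | ∃ l ∈ L, ∃ b, f = ridge σ l 1 b}).topologicalClosure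
  have hW : IsClosed (W : Set C(X, ℝ)) := Submodule.isClosed_topologicalClosure _
  -- Since `L` is a subspace, any weight `w` is absorbed into `l`.
  have hexp : ∀ l ∈ L, NormedSpace.exp l ∈ W := fun l hl =>
    exp_mem_of_pow_mem W hW l fun k => pow_mem_of_ridge_mem W hW σ hpoly l (fun w b =>
      Submodule.le_topologicalClosure _ (Submodule.subset_span
        ⟨w • l, L.smul_mem w hl, b, by ext x; simp⟩)) k
  let M : Submonoid C(X, ℝ) :=
    { carrier := {f | ∃ l ∈ L, f = NormedSpace.exp l}
      one_mem' := ⟨0, L.zero_mem, NormedSpace.exp_zero.symm⟩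
      mul_mem' := by
        rintro _ _ ⟨l, hl, rfl⟩ ⟨l', hl', rfl⟩
        exact ⟨l + l', L.add_mem hl hl', NormedSpace.exp_add.symm⟩ }
  have hA : (Algebra.adjoin ℝ (M : Set C(X, ℝ))).topologicalClosure = ⊤ := by
    apply ContinuousMap.subalgebra_topologicalClosure_eq_top_of_separatesPoints
    intro x y hxy
    obtain ⟨l, hl, hne⟩ := hL x y hxy
    refine ⟨_, ⟨NormedSpace.exp l, Algebra.subset_adjoin ⟨l, hl, rfl⟩, rfl⟩, ?_⟩
    have hev : ∀ z : X, NormedSpace.exp l z = Real.exp (l z) := fun z => by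
      rw [Real.exp_eq_exp_ℝ]
      exact NormedSpace.map_exp (ContinuousMap.evalAlgHom ℝ ℝ z)
        (continuous_eval_const z) l
    simpa [hev] using hne
  -- The exponentials already form a monoid, so the algebra they generate is their linear span.
  have hAW : Subalgebra.toSubmodule (Algebra.adjoin ℝ (M : Set C(X, ℝ))) ≤ W := by
    rw [Algebra.adjoin_eq_span, Submonoid.closure_eq, Submodule.span_le]
    rintro _ ⟨l, hl, rfl⟩
    exact hexp l hl
  rw [eq_top_iff]
  intro f _
  have hf : f ∈ (Algebra.adjoin ℝ (M : Set C(X, ℝ))).topologicalClosure := hA ▸ Algebra.mem_top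
  exact closure_minimal hAW hW hf

end UniversalApproximation

/-! ### Approximation by networks with one hidden layer -/

section FeedForward

theorem sum_smul_mem_feedForward (σ : ℝ → ℝ) {m n k : ℕ}
    (A : Fin k → EuclideanSpace ℝ (Fin m) →ᵃ[ℝ] ℝ) (a : Fin k → EuclideanSpace ℝ (Fin n)) :
    (fun x => ∑ i, σ (A i x) • a i) ∈ FeedForward σ m n := by
  let e : EuclideanSpace ℝ (Fin k) ≃ₗ[ℝ] (Fin k → ℝ) := WithLp.linearEquiv 2 ℝ (Fin k → ℝ)
  refine ⟨1, k, _, ((Fintype.linearCombination ℝ a).comp e.toLinearMap).toAffineMap, le_rfl,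
    .layer .input (e.symm.toLinearMap.toAffineMap.comp (AffineMap.pi A)), ?_⟩
  funext x
  simp [e, Fintype.linearCombination_apply]

/-- Single-hidden-layer networks as a span. -/
def shallowNetworks (σ : ℝ → ℝ) (m n : ℕ) :
    Submodule ℝ (EuclideanSpace ℝ (Fin m) → EuclideanSpace ℝ (Fin n)) :=
  Submodule.span ℝ {F | ∃ (A : EuclideanSpace ℝ (Fin m) →ᵃ[ℝ] ℝ) (a : EuclideanSpace ℝ (Fin n)),
    F = fun x => σ (A x) • a}

theorem shallowNetworks_subset_feedForward {σ : ℝ → ℝ} {m n : ℕ}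
    {F : EuclideanSpace ℝ (Fin m) → EuclideanSpace ℝ (Fin n)} (hF : F ∈ shallowNetworks σ m n) :
    F ∈ FeedForward σ m n := by
  obtain ⟨k, r, f, rfl⟩ := Submodule.mem_span_set'.1 hF
  choose A a hAa using fun i => (f i).2
  convert sum_smul_mem_feedForward σ A (fun i => r i • a i) using 1
  funext x
  simp [hAa, smul_comm (r _)]

theorem continuous_of_mem_shallowNetworks {σ : ℝ → ℝ} (hσ : Continuous σ) {m n : ℕ}
    {F : EuclideanSpace ℝ (Fin m) → EuclideanSpace ℝ (Fin n)} (hF : F ∈ shallowNetworks σ m n) :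
    Continuous F := by
  induction hF using Submodule.span_induction with
  | mem F h =>
    obtain ⟨A, a, rfl⟩ := h
    exact (hσ.comp A.continuous_of_finiteDimensional).smul continuous_const
  | zero => exact continuous_const
  | add F G _ _ hF hG => exact hF.add hG
  | smul r F _ hF => exact hF.const_smul r

theorem exists_shallowNetwork_eq_smul {σ : C(ℝ, ℝ)} {m n : ℕ} {C : Set (EuclideanSpace ℝ (Fin m))}
    (e : EuclideanSpace ℝ (Fin n)) {L : Set C(C, ℝ)}
    (hL : ∀ l ∈ L, ∃ A : EuclideanSpace ℝ (Fin m) →ₗ[ℝ] ℝ, ∀ x : C, l x = A x) {s : C(C, ℝ)}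
    (hs : s ∈ Submodule.span ℝ {f | ∃ l ∈ L, ∃ b, f = ridge σ l 1 b}) :
    ∃ F ∈ shallowNetworks σ m n, ∀ x : C, F x = s x • e := by
  induction hs using Submodule.span_induction with
  | mem s h =>
    obtain ⟨l, hl, b, rfl⟩ := h
    obtain ⟨A, hA⟩ := hL l hl
    exact ⟨_, Submodule.subset_span ⟨A.toAffineMap + AffineMap.const ℝ _ b, e, rfl⟩,
      fun x => by simp [hA]⟩
  | zero => exact ⟨0, Submodule.zero_mem _, fun x => by simp⟩
  | add s t _ _ hs ht =>
    obtain ⟨F, hF, hFs⟩ := hs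
    obtain ⟨G, hG, hGt⟩ := ht
    exact ⟨F + G, Submodule.add_mem _ hF hG, fun x => by simp [hFs, hGt, add_smul]⟩
  | smul r s _ hs =>
    obtain ⟨F, hF, hFs⟩ := hs
    exact ⟨r • F, Submodule.smul_mem _ r hF, fun x => by simp [hFs, mul_smul]⟩

/-- The universal approximation theorem for networks with a continuous non-polynomial activation
function. -/
theorem exists_feedForward_near {σ : ℝ → ℝ} (hσ : Continuous σ) (hpoly : ¬ IsPolynomialFun σ)
    {m n : ℕ} {C : Set (EuclideanSpace ℝ (Fin m))} (hC : IsCompact C)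
    {G : EuclideanSpace ℝ (Fin m) → EuclideanSpace ℝ (Fin n)} (hG : Continuous G) {δ : ℝ}
    (hδ : 0 < δ) : ∃ F ∈ FeedForward σ m n, Continuous F ∧ ∀ x ∈ C, ‖F x - G x‖ < δ := by
  have : CompactSpace C := isCompact_iff_compactSpace.1 hC
  let L : Submodule ℝ C(C, ℝ) :=
    { carrier := {l | ∃ A : EuclideanSpace ℝ (Fin m) →ₗ[ℝ] ℝ, ∀ x : C, l x = A x}
      zero_mem' := ⟨0, fun x => rfl⟩
      add_mem' := by
        rintro l l' ⟨A, hA⟩ ⟨B, hB⟩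
        exact ⟨A + B, fun x => by simp [hA, hB]⟩
      smul_mem' := by
        rintro r l ⟨A, hA⟩
        exact ⟨r • A, fun x => by simp [hA]⟩ }
  have hL : ∀ x y : C, x ≠ y → ∃ l ∈ L, l x ≠ l y := by
    intro x y hxy
    obtain ⟨i, hi⟩ : ∃ i, (x : EuclideanSpace ℝ (Fin m)) i ≠ (y : EuclideanSpace ℝ (Fin m)) i := by
      by_contra! h
      exact hxy (Subtype.ext (PiLp.ext h))
    exact ⟨⟨fun z : C => (z : EuclideanSpace ℝ (Fin m)) i, by fun_prop⟩,
      ⟨(EuclideanSpace.proj i : EuclideanSpace ℝ (Fin m) →L[ℝ] ℝ).toLinearMap, fun z => rfl⟩, hi⟩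
  have hdense := closure_span_ridge_eq_top ⟨σ, hσ⟩ hpoly L hL
  -- The `n` coordinate errors add up to at most `n δ / (n + 1) < δ`; the `+ 1` also covers `n = 0`.
  have hδn : 0 < δ / (n + 1) := by positivity
  have key : ∀ i : Fin n, ∃ F ∈ shallowNetworks σ m n, ∀ x : C,
      ‖F x - G x i • EuclideanSpace.single i (1 : ℝ)‖ < δ / (n + 1) := by
    intro i
    let Gi : C(C, ℝ) := ⟨fun x => G x i, by fun_prop⟩
    have hGi : Gi ∈ (Submodule.span ℝ {f | ∃ l ∈ L, ∃ b, f = ridge ⟨σ, hσ⟩ l 1 b}).topologicalClosure :=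
      hdense ▸ Submodule.mem_top
    obtain ⟨s, hs, hsd⟩ := Metric.mem_closure_iff.1 hGi _ hδn
    obtain ⟨F, hF, hFs⟩ := exists_shallowNetwork_eq_smul (EuclideanSpace.single i (1 : ℝ))
      (L := (L : Set C(C, ℝ))) (fun l hl => hl) hs
    refine ⟨F, hF, fun x => ?_⟩
    have hx := (ContinuousMap.dist_apply_le_dist (f := Gi) (g := s) x).trans_lt hsd
    rw [hFs, ← sub_smul, norm_smul]
    rw [dist_comm, Real.dist_eq] at hx
    simpa [Gi] using hx
  choose F hF hFG using key
  have hsum : ∑ i, F i ∈ shallowNetworks σ m n := Submodule.sum_mem _ fun i _ => hF i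
  refine ⟨_, shallowNetworks_subset_feedForward hsum, continuous_of_mem_shallowNetworks hσ hsum,
    fun x hx => ?_⟩
  have hGx : G x = ∑ i, G x i • EuclideanSpace.single i (1 : ℝ) := by
    ext j
    simp [Pi.single_apply]
  have hle : ‖(∑ i, F i) x - G x‖ ≤ n * (δ / (n + 1)) := by
    conv_lhs => rw [hGx, Finset.sum_apply, ← Finset.sum_sub_distrib]
    refine (norm_sum_le_of_le _ fun i _ => (hFG i ⟨x, hx⟩).le).trans_eq ?_
    simp
  refine hle.trans_lt ?_
  rw [← mul_div_assoc, div_lt_iff₀ (by positivity)]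
  nlinarith

end FeedForward

/-! ### Hyperbolic tangent and its inverse -/

section Tanh

theorem Real.hasDerivAt_tanh (x : ℝ) : HasDerivAt Real.tanh (1 - Real.tanh x ^ 2) x := by
  have h := (Real.hasDerivAt_sinh x).div (Real.hasDerivAt_cosh x) (Real.cosh_pos x).ne'
  have he : Real.tanh = Real.sinh / Real.cosh := funext Real.tanh_eq_sinh_div_cosh
  rw [he]
  refine h.congr_deriv ?_
  have := (Real.cosh_pos x).ne'
  rw [Pi.div_apply]
  field_simp

theorem Real.differentiable_tanh : Differentiable ℝ Real.tanh :=
  fun x => (Real.hasDerivAt_tanh x).differentiableAt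

theorem Real.tanh_le_self {x : ℝ} (hx : 0 ≤ x) : Real.tanh x ≤ x := by
  have hm : Monotone fun u => u - Real.tanh u :=
    monotone_of_deriv_nonneg (differentiable_id.sub Real.differentiable_tanh) fun u => by
      rw [((hasDerivAt_id' u).fun_sub (Real.hasDerivAt_tanh u)).deriv]
      nlinarith [sq_nonneg (Real.tanh u)]
  have := hm hx
  simp only [Real.tanh_zero, sub_zero] at this
  linarith

theorem Real.tanh_nonneg {x : ℝ} (hx : 0 ≤ x) : 0 ≤ Real.tanh x := by
  rw [Real.tanh_eq_sinh_div_cosh]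
  exact div_nonneg (Real.sinh_nonneg_iff.2 hx) (Real.cosh_pos x).le

theorem Real.le_artanh_self {x : ℝ} (hx : 0 ≤ x) (hx1 : x < 1) : x ≤ Real.artanh x := by
  have := Real.tanh_le_self (Real.artanh_nonneg hx)
  rwa [Real.tanh_artanh ⟨by linarith, hx1⟩] at this

theorem Real.continuousOn_artanh : ContinuousOn Real.artanh (Set.Ioo (-1) 1) := by
  unfold Real.artanh
  refine ContinuousOn.log (ContinuousOn.sqrt (ContinuousOn.div (by fun_prop) (by fun_prop) ?_)) ?_
  · intro x hx
    linarith [hx.2]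
  · intro x hx
    exact (Real.sqrt_pos.2 (div_pos (by linarith [hx.1]) (by linarith [hx.2]))).ne'

end Tanh

/-! ### Radial maps -/

section Radial

variable {E : Type*} [NormedAddCommGroup E] [NormedSpace ℝ E]

/-- The map of a normed space that preserves directions and turns the norm `r` into `f r`. -/
def radial (f : ℝ → ℝ) (v : E) : E := (f ‖v‖ / ‖v‖) • v

theorem norm_radial {f : ℝ → ℝ} (h0 : f 0 = 0) (v : E) : ‖radial f v‖ = |f ‖v‖| := by
  rcases eq_or_ne v 0 with rfl | hv
  · simp [radial, h0]
  · rw [radial, norm_smul, norm_div, norm_norm, Real.norm_eq_abs,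
      div_mul_cancel₀ _ (norm_ne_zero_iff.2 hv)]

theorem radial_radial {f g : ℝ → ℝ} (h0 : f 0 = 0) (hg0 : g 0 = 0) {v : E} (hf : 0 ≤ f ‖v‖)
    (hgf : g (f ‖v‖) = ‖v‖) : radial g (radial f v) = v := by
  rcases eq_or_ne v 0 with rfl | hv
  · simp [radial]
  have hv' : ‖v‖ ≠ 0 := norm_ne_zero_iff.2 hv
  have hfv : f ‖v‖ ≠ 0 := fun h => hv' (by rw [← hgf, h, hg0])
  rw [radial, norm_radial h0, abs_of_nonneg hf, hgf, radial, smul_smul,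
    div_mul_div_cancel₀ hfv, div_self hv', one_smul]

theorem continuousOn_radial {f : ℝ → ℝ} {s : Set E} (h0 : f 0 = 0)
    (hf : ContinuousOn (fun v : E => f ‖v‖) s) : ContinuousOn (radial f) s := by
  intro v hv
  rcases eq_or_ne v 0 with rfl | hv0
  · have hz : radial f (0 : E) = 0 := by simp [radial]
    rw [ContinuousWithinAt, hz, tendsto_zero_iff_norm_tendsto_zero]
    have := (hf 0 hv).abs
    simpa [ContinuousWithinAt, h0, norm_radial] using this
  · exact ((hf v hv).div continuous_norm.continuousWithinAt (norm_ne_zero_iff.2 hv0)).smul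
      continuousWithinAt_id

end Radial

/-! ### Geodesics from the centre, exponential and logarithm -/

section Geodesics

variable {c : ℝ} {n : ℕ}

theorem fderiv_poincareMetric {x : EuclideanSpace ℝ (Fin n)} (hx : c * ‖x‖ ^ 2 < 1)
    (i j l : Fin n) :
    fderiv ℝ (fun z => poincareMetric c n z j l) x (EuclideanSpace.single i 1)
      = 16 * c * x i / (1 - c * ‖x‖ ^ 2) ^ 3 * (1 : Matrix (Fin n) (Fin n) ℝ) j l := by
  have hu : 1 - c * ‖x‖ ^ 2 ≠ 0 := by linarith
  -- With `u = 1 - c‖x‖²` the conformal factor is `4u⁻²`, so the derivative is `-8u⁻³ · (-2c xᵢ)`.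
  have h1 : HasFDerivAt (fun z : EuclideanSpace ℝ (Fin n) => 1 - c * ‖z‖ ^ 2)
      (-(c • (2 • (innerSL ℝ x).comp (ContinuousLinearMap.id ℝ _)))) x :=
    ((hasFDerivAt_id x).norm_sq.const_mul c).const_sub 1
  have h2 : HasDerivAt (fun u : ℝ => (2 / u) ^ 2) (-8 / (1 - c * ‖x‖ ^ 2) ^ 3)
      (1 - c * ‖x‖ ^ 2) := by
    have := ((hasDerivAt_inv hu).const_mul 2).pow 2
    simp only [← div_eq_mul_inv] at this
    refine this.congr_deriv ?_
    push_cast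
    field_simp
    ring
  have h3 := (h2.comp_hasFDerivAt x h1).mul_const ((1 : Matrix (Fin n) (Fin n) ℝ) j l)
  have h4 : (fun z => poincareMetric c n z j l) = fun z : EuclideanSpace ℝ (Fin n) =>
      ((fun u : ℝ => (2 / u) ^ 2) ∘ fun z : EuclideanSpace ℝ (Fin n) => 1 - c * ‖z‖ ^ 2) z
        * (1 : Matrix (Fin n) (Fin n) ℝ) j l := by
    funext z
    simp [poincareMetric]
  rw [h4, h3.fderiv]
  simp [EuclideanSpace.inner_single_right]
  ring

theorem poincareMetric_inv {x : EuclideanSpace ℝ (Fin n)} (hx : c * ‖x‖ ^ 2 < 1) :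
    (poincareMetric c n x)⁻¹ = ((1 - c * ‖x‖ ^ 2) / 2) ^ 2 • (1 : Matrix (Fin n) (Fin n) ℝ) := by
  have hu : 1 - c * ‖x‖ ^ 2 ≠ 0 := by linarith
  refine Matrix.inv_eq_left_inv ?_
  rw [poincareMetric, Matrix.smul_mul, Matrix.mul_smul, smul_smul, one_mul]
  rw [show ((1 - c * ‖x‖ ^ 2) / 2) ^ 2 * (2 / (1 - c * ‖x‖ ^ 2)) ^ 2 = 1 by field_simp, one_smul]

theorem christoffel_poincareMetric {x : EuclideanSpace ℝ (Fin n)} (hx : c * ‖x‖ ^ 2 < 1)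
    (k i j : Fin n) :
    christoffel (poincareMetric c n) k i j x = 2 * c / (1 - c * ‖x‖ ^ 2) *
      ((1 : Matrix (Fin n) (Fin n) ℝ) j k * x i + (1 : Matrix (Fin n) (Fin n) ℝ) i k * x j
        - (1 : Matrix (Fin n) (Fin n) ℝ) i j * x k) := by
  have hu : 1 - c * ‖x‖ ^ 2 ≠ 0 := by linarith
  simp only [christoffel, fderiv_poincareMetric hx, poincareMetric_inv hx]
  rw [Finset.sum_eq_single k]
  · simp only [Matrix.smul_apply, Matrix.one_apply_eq, smul_eq_mul]
    field_simp
    ring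
  · intro l _ hl
    simp [Matrix.one_apply_ne hl.symm]
  · simp

/-- The acceleration of a geodesic with position `x` and velocity `v`. -/
def geodesicAccel (c : ℝ) (x v : EuclideanSpace ℝ (Fin n)) : EuclideanSpace ℝ (Fin n) :=
  (2 * c / (1 - c * ‖x‖ ^ 2)) • (‖v‖ ^ 2 • x - (2 * inner ℝ x v) • v)

theorem christoffel_accel {x : EuclideanSpace ℝ (Fin n)} (hx : c * ‖x‖ ^ 2 < 1)
    (v : EuclideanSpace ℝ (Fin n)) :
    (WithLp.toLp 2 fun k => -∑ i, ∑ j, christoffel (poincareMetric c n) k i j x * v i * v j)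
      = geodesicAccel c x v := by
  ext k
  have hin : inner ℝ x v = ∑ i, x i * v i := by simp [PiLp.inner_apply, mul_comm]
  have h1 : ∑ i, ∑ j, (1 : Matrix (Fin n) (Fin n) ℝ) j k * x i * v i * v j
      = inner ℝ x v * v k := by
    rw [hin, Finset.sum_mul]
    refine Finset.sum_congr rfl fun i _ => ?_
    rw [Finset.sum_eq_single k] <;> simp +contextual
  have h2 : ∑ i, ∑ j, (1 : Matrix (Fin n) (Fin n) ℝ) i k * x j * v i * v j
      = inner ℝ x v * v k := by
    rw [Finset.sum_comm, ← h1]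
    exact Finset.sum_congr rfl fun i _ => Finset.sum_congr rfl fun j _ => by ring
  have h3 : ∑ i, ∑ j, (1 : Matrix (Fin n) (Fin n) ℝ) i j * x k * v i * v j
      = ‖v‖ ^ 2 * x k := by
    rw [EuclideanSpace.real_norm_sq_eq, Finset.sum_mul]
    refine Finset.sum_congr rfl fun i _ => ?_
    rw [Finset.sum_eq_single i]
    · simp
      ring
    · intro j _ hj
      simp [Matrix.one_apply_ne hj.symm]
    · simp
  have h4 : ∑ i, ∑ j, christoffel (poincareMetric c n) k i j x * v i * v j
      = 2 * c / (1 - c * ‖x‖ ^ 2) * (inner ℝ x v * v k + inner ℝ x v * v k - ‖v‖ ^ 2 * x k) := by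
    nth_rewrite 1 [← h1]
    rw [← h2, ← h3, ← Finset.sum_add_distrib, ← Finset.sum_sub_distrib, Finset.mul_sum]
    refine Finset.sum_congr rfl fun i _ => ?_
    rw [← Finset.sum_add_distrib, ← Finset.sum_sub_distrib, Finset.mul_sum]
    refine Finset.sum_congr rfl fun j _ => ?_
    rw [christoffel_poincareMetric hx]
    ring
  simp only [h4, geodesicAccel, PiLp.smul_apply, PiLp.sub_apply, smul_eq_mul]
  ring

namespace PoincareBall

/-- The straight segment through `0`, parametrised with constant hyperbolic speed, is a geodesic. -/
theorem isGeodesic_radial (hc : 0 < c) (v : EuclideanSpace ℝ (Fin n)) :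
    IsGeodesic c (fun t => (Real.tanh (√c * ‖v‖ * t) / (√c * ‖v‖)) • v)
      (fun t => (1 - Real.tanh (√c * ‖v‖ * t) ^ 2) • v) := by
  rcases eq_or_ne v 0 with rfl | hv
  · refine ⟨fun t _ => by simp, fun t _ => ?_, fun t _ => ?_⟩
    · simpa using hasDerivWithinAt_const t _ (0 : EuclideanSpace ℝ (Fin n))
    · rw [christoffel_accel (by simp)]
      simpa [geodesicAccel] using hasDerivWithinAt_const t _ (0 : EuclideanSpace ℝ (Fin n))
  have hr : 0 < ‖v‖ := norm_pos_iff.2 hv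
  have ha : 0 < √c * ‖v‖ := by positivity
  have hsq : √c ^ 2 = c := Real.sq_sqrt hc.le
  have hnorm : ∀ t, c * ‖(Real.tanh (√c * ‖v‖ * t) / (√c * ‖v‖)) • v‖ ^ 2
      = Real.tanh (√c * ‖v‖ * t) ^ 2 := fun t => by
    rw [norm_smul, mul_pow, Real.norm_eq_abs, sq_abs, div_pow, mul_pow, hsq]
    field_simp
  have hlt : ∀ t, Real.tanh (√c * ‖v‖ * t) ^ 2 < 1 := fun t => Real.tanh_sq_lt_one _
  have hT : ∀ t, HasDerivAt (fun t => Real.tanh (√c * ‖v‖ * t))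
      ((1 - Real.tanh (√c * ‖v‖ * t) ^ 2) * (√c * ‖v‖)) t := fun t => by
    have h := (Real.hasDerivAt_tanh (√c * ‖v‖ * t)).comp t
      ((hasDerivAt_id' t).const_mul (√c * ‖v‖))
    rw [mul_one] at h
    exact h
  refine ⟨fun t _ => by rw [hnorm]; exact hlt t, fun t _ => ?_, fun t _ => ?_⟩
  · have := ((hT t).div_const (√c * ‖v‖)).smul_const v
    rw [mul_div_cancel_right₀ _ ha.ne'] at this
    exact this.hasDerivWithinAt
  -- Position and velocity are collinear, so the bracket in `geodesicAccel` reduces to minus squared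
  -- speed times position.
  · rw [christoffel_accel (by rw [hnorm]; exact hlt t), geodesicAccel, hnorm]
    have h := (((hT t).fun_pow 2).const_sub 1).smul_const v
    refine (h.congr_deriv ?_).hasDerivWithinAt
    set T := Real.tanh (√c * ‖v‖ * t)
    have hT1 : 1 - T ^ 2 ≠ 0 := by linarith [hlt t]
    rw [inner_smul_left, inner_smul_right, real_inner_self_eq_norm_sq, norm_smul, mul_pow,
      Real.norm_eq_abs, sq_abs, smul_smul, smul_smul, ← sub_smul, smul_smul]
    congr 1
    simp only [conj_trivial]
    field_simp
    rw [hsq]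
    ring

theorem contDiffOn_geodesic_field (c : ℝ) {s : Set (EuclideanSpace ℝ (Fin n))}
    (hs : ∀ x ∈ s, c * ‖x‖ ^ 2 < 1) (t : Set (EuclideanSpace ℝ (Fin n))) :
    ContDiffOn ℝ 1 (fun p : EuclideanSpace ℝ (Fin n) × EuclideanSpace ℝ (Fin n) =>
      (p.2, geodesicAccel c p.1 p.2)) (s ×ˢ t) := by
  unfold geodesicAccel
  refine contDiff_snd.contDiffOn.prodMk
    (ContDiffOn.fun_smul (ContDiffOn.fun_div contDiffOn_const ?_ ?_) ?_)
  · exact (contDiff_const.sub (contDiff_const.mul (contDiff_fst.norm_sq ℝ))).contDiffOn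
  · intro p hp
    linarith [hs _ hp.1]
  · exact (((contDiff_snd.norm_sq ℝ).smul contDiff_fst).sub
      ((contDiff_const.mul (contDiff_fst.inner ℝ contDiff_snd)).smul contDiff_snd)).contDiffOn

theorem IsGeodesic.continuousOn_left {γ γ' : ℝ → EuclideanSpace ℝ (Fin n)}
    (h : IsGeodesic c γ γ') : ContinuousOn γ (Set.Icc 0 1) :=
  fun t ht => (h.velocity t ht).continuousWithinAt

theorem IsGeodesic.continuousOn_right {γ γ' : ℝ → EuclideanSpace ℝ (Fin n)}
    (h : IsGeodesic c γ γ') : ContinuousOn γ' (Set.Icc 0 1) :=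
  fun t ht => (h.acceleration t ht).continuousWithinAt

/-- Compactness of `[0, 1]` keeps the curve away from the boundary, where the geodesic field blows
up. -/
theorem IsGeodesic.exists_bounds {γ γ' : ℝ → EuclideanSpace ℝ (Fin n)}
    (h : IsGeodesic c γ γ') : ∃ r R : ℝ, 0 ≤ r ∧ c * r ^ 2 < 1 ∧
      ∀ t ∈ Set.Icc (0 : ℝ) 1, ‖γ t‖ ≤ r ∧ ‖γ' t‖ ≤ R := by
  obtain ⟨t₀, ht₀, hmax⟩ := isCompact_Icc.exists_isMaxOn (Set.nonempty_Icc.2 zero_le_one)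
    h.continuousOn_left.norm
  obtain ⟨R, hR⟩ := isCompact_Icc.exists_bound_of_continuousOn h.continuousOn_right
  exact ⟨‖γ t₀‖, R, norm_nonneg _, h.mem_ball t₀ ht₀, fun t ht => ⟨hmax ht, hR t ht⟩⟩

theorem IsGeodesic.hasDerivWithinAt_prod {γ γ' : ℝ → EuclideanSpace ℝ (Fin n)}
    (h : IsGeodesic c γ γ') {t : ℝ} (ht : t ∈ Set.Ico (0 : ℝ) 1) :
    HasDerivWithinAt (fun t => (γ t, γ' t)) (γ' t, geodesicAccel c (γ t) (γ' t)) (Set.Ici t) t := by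
  have ht' := Set.Ico_subset_Icc_self ht
  rw [← christoffel_accel (h.mem_ball t ht')]
  exact ((h.velocity t ht').prodMk (h.acceleration t ht')).mono_of_mem_nhdsWithin
    (Icc_mem_nhdsGE_of_mem ht)

/-- A geodesic is determined by its initial position and velocity. -/
theorem IsGeodesic.eqOn (hc : 0 < c) {γ γ' η η' : ℝ → EuclideanSpace ℝ (Fin n)}
    (h : IsGeodesic c γ γ') (k : IsGeodesic c η η') (h0 : γ 0 = η 0) (h0' : γ' 0 = η' 0) :
    Set.EqOn γ η (Set.Icc 0 1) := by
  obtain ⟨r₁, R₁, hr₁, hcr₁, hb₁⟩ := h.exists_bounds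
  obtain ⟨r₂, R₂, hr₂, hcr₂, hb₂⟩ := k.exists_bounds
  have hmax : c * (max r₁ r₂) ^ 2 < 1 := by
    rcases max_choice r₁ r₂ with h | h <;> rwa [h]
  have hball : ∀ x ∈ Metric.closedBall (0 : EuclideanSpace ℝ (Fin n)) (max r₁ r₂),
      c * ‖x‖ ^ 2 < 1 := fun x hx => by
    refine lt_of_le_of_lt ?_ hmax
    gcongr
    simpa using hx
  -- A C¹ field is Lipschitz on a convex compact set, which is what ODE uniqueness requires.
  obtain ⟨K, hK⟩ := (contDiffOn_geodesic_field c hball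
      (Metric.closedBall 0 (max R₁ R₂))).exists_lipschitzOnWith one_ne_zero
    ((convex_closedBall _ _).prod (convex_closedBall _ _))
    ((isCompact_closedBall _ _).prod (isCompact_closedBall _ _))
  have := ODE_solution_unique_of_mem_Icc_right (v := fun _ p => (p.2, geodesicAccel c p.1 p.2))
    (fun t _ => hK) (h.continuousOn_left.prodMk h.continuousOn_right)
    (fun t ht => h.hasDerivWithinAt_prod ht)
    (fun t ht => ⟨by simp [(hb₁ t (Set.Ico_subset_Icc_self ht)).1],
      by simp [(hb₁ t (Set.Ico_subset_Icc_self ht)).2]⟩)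
    (k.continuousOn_left.prodMk k.continuousOn_right)
    (fun t ht => k.hasDerivWithinAt_prod ht)
    (fun t ht => ⟨by simp [(hb₂ t (Set.Ico_subset_Icc_self ht)).1],
      by simp [(hb₂ t (Set.Ico_subset_Icc_self ht)).2]⟩)
    (by simp only [h0, h0'])
  exact fun t ht => congrArg Prod.fst (this ht)

/-- Norm of `Exp₀ v` as a function of `‖v‖`. -/
def expNorm (c r : ℝ) : ℝ := Real.tanh (√c * r) / √c

/-- Norm of `Log₀ y` as a function of `‖y‖`. -/
def logNorm (c r : ℝ) : ℝ := Real.artanh (√c * r) / √c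

theorem expNorm_zero (c : ℝ) : expNorm c 0 = 0 := by simp [expNorm]

theorem logNorm_zero (c : ℝ) : logNorm c 0 = 0 := by simp [logNorm]

theorem mul_expNorm_sq_lt_one (hc : 0 < c) (r : ℝ) : c * expNorm c r ^ 2 < 1 := by
  rw [expNorm, div_pow, Real.sq_sqrt hc.le, mul_div_cancel₀ _ hc.ne']
  exact Real.tanh_sq_lt_one _

theorem sqrt_mul_norm_lt_one (hc : 0 < c) {r : ℝ} (h : c * r ^ 2 < 1) :
    √c * r < 1 := by
  have : (√c * r) ^ 2 < 1 := by rwa [mul_pow, Real.sq_sqrt hc.le]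
  exact (abs_lt.1 ((sq_lt_one_iff_abs_lt_one _).1 this)).2

theorem mul_norm_radial_expNorm_sq_lt_one (hc : 0 < c) (v : EuclideanSpace ℝ (Fin n)) :
    c * ‖radial (expNorm c) v‖ ^ 2 < 1 := by
  rw [norm_radial (expNorm_zero c), sq_abs]
  exact mul_expNorm_sq_lt_one hc _

/-- Existence and uniqueness of the endpoint determine the choice made by `Classical.epsilon` in
`Exp`. -/
theorem reachedByGeodesic_origin_iff (hc : 0 < c) (v : EuclideanSpace ℝ (Fin n))
    (y : PoincareBall c n) :
    ReachedByGeodesic (origin c n) v y ↔ y.val = radial (expNorm c) v := by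
  have hrad : (Real.tanh (√c * ‖v‖ * 1) / (√c * ‖v‖)) • v = radial (expNorm c) v := by
    rw [radial, expNorm, mul_one, div_div]
  have h0 : (origin c n).val = 0 := rfl
  constructor
  · rintro ⟨γ, γ', hγ, hγ0, hγ0', hγ1⟩
    rw [← hγ1, hγ.eqOn hc (isGeodesic_radial hc v) (by simp [hγ0, h0]) (by simp [hγ0'])
      (Set.right_mem_Icc.2 zero_le_one), ← hrad]
  · intro hy
    exact ⟨_, _, isGeodesic_radial hc v, by simp [h0], by simp, by rw [hy]; exact hrad⟩

theorem val_exp (hc : 0 < c) (v : EuclideanSpace ℝ (Fin n)) :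
    ((origin c n).Exp v).val = radial (expNorm c) v :=
  (reachedByGeodesic_origin_iff hc v _).1 (Classical.epsilon_spec
    ⟨(⟨radial (expNorm c) v, mul_norm_radial_expNorm_sq_lt_one hc v⟩ : PoincareBall c n),
      (reachedByGeodesic_origin_iff hc v _).2 rfl⟩)

theorem val_injective : Function.Injective (val : PoincareBall c n → _) := Subtype.val_injective

theorem radial_logNorm_exp (hc : 0 < c) (v : EuclideanSpace ℝ (Fin n)) :
    radial (logNorm c) ((origin c n).Exp v).val = v := by
  have hs : 0 < √c := Real.sqrt_pos.2 hc
  rw [val_exp hc]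
  refine radial_radial (expNorm_zero c) (logNorm_zero c) ?_ ?_
  · exact div_nonneg (Real.tanh_nonneg (by positivity)) hs.le
  · rw [logNorm, expNorm, mul_div_cancel₀ _ hs.ne', Real.artanh_tanh, mul_div_cancel_left₀ _ hs.ne']

theorem exp_injective (hc : 0 < c) : Function.Injective (Exp (origin c n)) :=
  fun v w h => by rw [← radial_logNorm_exp hc v, h, radial_logNorm_exp hc]

theorem exp_radial_logNorm (hc : 0 < c) (y : PoincareBall c n) :
    (origin c n).Exp (radial (logNorm c) y.val) = y := by
  have hs : 0 < √c := Real.sqrt_pos.2 hc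
  have hy : √c * ‖y.val‖ < 1 := sqrt_mul_norm_lt_one hc y.2
  have hy0 : 0 ≤ √c * ‖y.val‖ := by positivity
  refine val_injective ?_
  rw [val_exp hc]
  refine radial_radial (logNorm_zero c) (expNorm_zero c) ?_ ?_
  · exact div_nonneg (Real.artanh_nonneg (by positivity)) hs.le
  · rw [logNorm, expNorm, mul_div_cancel₀ _ hs.ne', Real.tanh_artanh ⟨by linarith, hy⟩,
      mul_div_cancel_left₀ _ hs.ne']

theorem log_eq (hc : 0 < c) (y : PoincareBall c n) :
    (origin c n).Log y = radial (logNorm c) y.val := by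
  refine exp_injective hc ?_
  rw [exp_radial_logNorm hc]
  exact Function.invFun_eq ⟨_, exp_radial_logNorm hc y⟩

theorem exp_log (hc : 0 < c) (y : PoincareBall c n) :
    (origin c n).Exp ((origin c n).Log y) = y := by
  rw [log_eq hc, exp_radial_logNorm hc]

end PoincareBall

end Geodesics

/-! ### The hyperbolic distance and its topology -/

section HyperbolicTopology

namespace PoincareBall

variable {c : ℝ} {n : ℕ}

/-- The denominator in the formula for the hyperbolic metric. -/
def hdenom (c : ℝ) (x y : EuclideanSpace ℝ (Fin n)) : ℝ :=
  1 - 2 * c * inner ℝ x y + c ^ 2 * ‖x‖ ^ 2 * ‖y‖ ^ 2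

/-- The Möbius difference of `y` and `x`. -/
def mobiusDiff (c : ℝ) (x y : EuclideanSpace ℝ (Fin n)) : EuclideanSpace ℝ (Fin n) :=
  (hdenom c x y)⁻¹ • ((1 - c * ‖x‖ ^ 2) • y - (1 - 2 * c * inner ℝ x y + c * ‖y‖ ^ 2) • x)

theorem val_mem (x : PoincareBall c n) : c * ‖x.val‖ ^ 2 < 1 := x.2

theorem hdist_eq (x y : PoincareBall c n) :
    hdist x y = 2 / √c * Real.artanh (√c * ‖mobiusDiff c x.val y.val‖) := rfl

/-- This form shows positivity on the ball and `c‖x - y‖² < hdenom c x y`, which keeps the Möbius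
difference inside the ball. -/
theorem hdenom_eq (x y : EuclideanSpace ℝ (Fin n)) :
    hdenom c x y = (1 - c * ‖x‖ ^ 2) * (1 - c * ‖y‖ ^ 2) + c * ‖x - y‖ ^ 2 := by
  rw [hdenom, norm_sub_sq_real]
  ring

theorem hdenom_pos (hc : 0 < c) {x y : EuclideanSpace ℝ (Fin n)} (hx : c * ‖x‖ ^ 2 < 1)
    (hy : c * ‖y‖ ^ 2 < 1) : 0 < hdenom c x y := by
  rw [hdenom_eq]
  have : 0 < (1 - c * ‖x‖ ^ 2) * (1 - c * ‖y‖ ^ 2) := mul_pos (by linarith) (by linarith)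
  positivity

theorem hdenom_mul_norm_mobiusDiff_sq (hc : 0 < c) {x y : EuclideanSpace ℝ (Fin n)}
    (hx : c * ‖x‖ ^ 2 < 1) (hy : c * ‖y‖ ^ 2 < 1) :
    hdenom c x y * ‖mobiusDiff c x y‖ ^ 2 = ‖x - y‖ ^ 2 := by
  have hD := hdenom_pos hc hx hy
  have hnum : ‖(1 - c * ‖x‖ ^ 2) • y - (1 - 2 * c * inner ℝ x y + c * ‖y‖ ^ 2) • x‖ ^ 2
      = ‖x - y‖ ^ 2 * hdenom c x y := by
    rw [norm_sub_sq_real, norm_sub_sq_real, inner_smul_left, inner_smul_right, norm_smul, norm_smul,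
      mul_pow, mul_pow, Real.norm_eq_abs, Real.norm_eq_abs, sq_abs, sq_abs, real_inner_comm x y,
      hdenom]
    simp only [conj_trivial]
    ring
  rw [mobiusDiff, norm_smul, mul_pow, hnum, Real.norm_eq_abs, sq_abs]
  field_simp

theorem sqrt_mul_norm_mobiusDiff_lt_one (hc : 0 < c) {x y : EuclideanSpace ℝ (Fin n)}
    (hx : c * ‖x‖ ^ 2 < 1) (hy : c * ‖y‖ ^ 2 < 1) : √c * ‖mobiusDiff c x y‖ < 1 := by
  refine sqrt_mul_norm_lt_one hc ?_
  have hD := hdenom_pos hc hx hy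
  have h := hdenom_mul_norm_mobiusDiff_sq hc hx hy
  have h' := hdenom_eq (c := c) x y
  have : 0 < (1 - c * ‖x‖ ^ 2) * (1 - c * ‖y‖ ^ 2) := mul_pos (by linarith) (by linarith)
  have h2 : hdenom c x y * (c * ‖mobiusDiff c x y‖ ^ 2) < hdenom c x y * 1 := by
    rw [mul_left_comm, h]
    linarith
  exact lt_of_mul_lt_mul_left h2 hD.le

theorem norm_sub_le_hdist (hc : 0 < c) (x y : PoincareBall c n) :
    ‖x.val - y.val‖ ≤ 3 / 2 * hdist x y := by
  have hx : c * ‖x.val‖ ^ 2 < 1 := x.val_mem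
  have hy : c * ‖y.val‖ ^ 2 < 1 := y.val_mem
  have hs : 0 < √c := Real.sqrt_pos.2 hc
  set q := ‖mobiusDiff c x.val y.val‖ with hq
  have h1 : √c * q ≤ Real.artanh (√c * q) :=
    Real.le_artanh_self (by positivity) (sqrt_mul_norm_mobiusDiff_lt_one hc hx hy)
  -- The product in `hdenom_eq` is at most 1 and `c‖x - y‖²` at most 4; then `5 ≤ 3²` yields the
  -- factor 3 below.
  have h2 : hdenom c x.val y.val ≤ 5 := by
    rw [hdenom_eq]
    have hxy : ‖x.val - y.val‖ ^ 2 ≤ 2 * ‖x.val‖ ^ 2 + 2 * ‖y.val‖ ^ 2 := by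
      have := parallelogram_law_with_norm ℝ x.val y.val
      nlinarith [mul_self_nonneg ‖x.val + y.val‖]
    have hX : 0 ≤ c * ‖x.val‖ ^ 2 := by positivity
    have hY : 0 ≤ c * ‖y.val‖ ^ 2 := by positivity
    nlinarith [mul_le_mul_of_nonneg_left hxy hc.le]
  have h3 : ‖x.val - y.val‖ ≤ 3 * q := by
    refine le_of_sq_le_sq ?_ (by positivity)
    rw [← hdenom_mul_norm_mobiusDiff_sq hc hx hy, mul_pow, ← hq]
    nlinarith [sq_nonneg q]
  have h4 : q ≤ hdist x y / 2 := by
    rw [hdist_eq, ← hq]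
    have : q ≤ Real.artanh (√c * q) / √c := by
      rw [le_div_iff₀ hs]
      linarith
    calc q ≤ Real.artanh (√c * q) / √c := this
      _ = _ := by ring
  linarith

theorem hdist_self (hc : 0 < c) (x : PoincareBall c n) : hdist x x = 0 := by
  have h := hdenom_mul_norm_mobiusDiff_sq hc x.val_mem x.val_mem
  have hD := hdenom_pos hc x.val_mem x.val_mem
  have : ‖mobiusDiff c x.val x.val‖ = 0 := by
    rw [sub_self, norm_zero] at h
    simpa [hD.ne'] using h
  rw [hdist_eq, this]
  simp

theorem continuousOn_hdist (hc : 0 < c) :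
    ContinuousOn (fun p : EuclideanSpace ℝ (Fin n) × EuclideanSpace ℝ (Fin n) =>
      2 / √c * Real.artanh (√c * ‖mobiusDiff c p.1 p.2‖))
      {p | c * ‖p.1‖ ^ 2 < 1 ∧ c * ‖p.2‖ ^ 2 < 1} := by
  have hm : ContinuousOn (fun p : EuclideanSpace ℝ (Fin n) × EuclideanSpace ℝ (Fin n) =>
      mobiusDiff c p.1 p.2) {p | c * ‖p.1‖ ^ 2 < 1 ∧ c * ‖p.2‖ ^ 2 < 1} := by
    unfold mobiusDiff
    refine ContinuousOn.smul (ContinuousOn.inv₀ ?_ fun p hp => (hdenom_pos hc hp.1 hp.2).ne') ?_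
    · unfold hdenom
      fun_prop
    · fun_prop
  refine continuousOn_const.mul (Real.continuousOn_artanh.comp
    (continuousOn_const.mul hm.norm) fun p hp => ?_)
  refine ⟨?_, sqrt_mul_norm_mobiusDiff_lt_one hc hp.1 hp.2⟩
  have : 0 ≤ √c * ‖mobiusDiff c p.1 p.2‖ := by positivity
  linarith

theorem isOpen_setOf_hdist_lt (y : PoincareBall c n) {ε : ℝ} (hε : 0 < ε) :
    IsOpen {z | hdist z y < ε} :=
  TopologicalSpace.isOpen_generateFrom_of_mem ⟨y, ε, hε, rfl⟩

theorem continuous_val (hc : 0 < c) : Continuous (val : PoincareBall c n → _) := by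
  refine continuous_iff_continuousAt.2 fun p => Metric.tendsto_nhds.2 fun ε hε => ?_
  filter_upwards [(isOpen_setOf_hdist_lt p (by positivity : 0 < 2 / 3 * ε)).mem_nhds
    (by simp only [Set.mem_ofPred_eq, hdist_self hc]; positivity)] with z hz
  rw [dist_eq_norm]
  have := norm_sub_le_hdist hc z p
  have hz' : hdist z p < 2 / 3 * ε := hz
  linarith

/-- The topology of the hyperbolic metric is the Euclidean subspace topology. -/
theorem isInducing_val (hc : 0 < c) : Topology.IsInducing (val : PoincareBall c n → _) := by
  refine ⟨le_antisymm (continuous_iff_le_induced.1 (continuous_val hc)) (le_generateFrom ?_)⟩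
  rintro _ ⟨y, ε, hε, rfl⟩
  have hb : IsOpen {x : EuclideanSpace ℝ (Fin n) | c * ‖x‖ ^ 2 < 1} :=
    isOpen_lt (by fun_prop) continuous_const
  have hcont : ContinuousOn (fun x : EuclideanSpace ℝ (Fin n) =>
      2 / √c * Real.artanh (√c * ‖mobiusDiff c x y.val‖)) {x | c * ‖x‖ ^ 2 < 1} :=
    (continuousOn_hdist hc).comp (f := fun x : EuclideanSpace ℝ (Fin n) => (x, y.val))
      (by fun_prop) fun x hx => ⟨hx, y.val_mem⟩
  -- A `d_c`-ball is Euclidean open: the distance formula is continuous on the open ball.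
  refine isOpen_induced_iff.2 ⟨_, hcont.isOpen_inter_preimage hb (isOpen_Iio (a := ε)), ?_⟩
  ext z
  exact ⟨fun hz => hz.2, fun hz => ⟨z.val_mem, hz⟩⟩

theorem continuous_hdist (hc : 0 < c) :
    Continuous fun p : PoincareBall c n × PoincareBall c n => hdist p.1 p.2 := by
  simp only [hdist_eq]
  exact (continuousOn_hdist hc).comp_continuous
    (f := fun p : PoincareBall c n × PoincareBall c n => (p.1.val, p.2.val))
    (((continuous_val hc).comp continuous_fst).prodMk ((continuous_val hc).comp continuous_snd))
    fun p => ⟨p.1.val_mem, p.2.val_mem⟩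

theorem continuous_exp (hc : 0 < c) : Continuous (Exp (origin c n)) := by
  rw [(isInducing_val hc).continuous_iff, ← continuousOn_univ]
  have he : val ∘ Exp (origin c n) = radial (expNorm c) := funext fun v => val_exp hc v
  rw [he]
  refine continuousOn_radial (expNorm_zero c) ?_
  unfold expNorm
  exact ((Real.differentiable_tanh.continuous.comp (by fun_prop)).div_const _).continuousOn

theorem continuous_log (hc : 0 < c) : Continuous (Log (origin c n)) := by
  have he : Log (origin c n) = fun y => radial (logNorm c) y.val := funext fun y => log_eq hc y
  rw [he]
  refine ContinuousOn.comp_continuous (g := radial (logNorm c)) (f := val)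
    (s := {x | c * ‖x‖ ^ 2 < 1}) (continuousOn_radial (logNorm_zero c) ?_) (continuous_val hc) val_mem
  unfold logNorm
  refine (Real.continuousOn_artanh.comp (by fun_prop) fun x hx => ?_).div_const _
  refine ⟨?_, sqrt_mul_norm_lt_one hc hx⟩
  have : 0 ≤ √c * ‖x‖ := by positivity
  linarith

/-- On a compact set of base points, `Exp₀` is uniformly continuous for the hyperbolic metric. -/
theorem exists_forall_hdist_exp_lt (hc : 0 < c) {C : Set (EuclideanSpace ℝ (Fin n))}
    (hC : IsCompact C) {ε : ℝ} (hε : 0 < ε) : ∃ δ > 0, ∀ u ∈ C, ∀ v, ‖v - u‖ < δ →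
      hdist (Exp (origin c n) u) (Exp (origin c n) v) < ε := by
  have h1 : Continuous fun p : EuclideanSpace ℝ (Fin n) × EuclideanSpace ℝ (Fin n) =>
      (Exp (origin c n) p.2, Exp (origin c n) (p.2 + p.1)) :=
    ((continuous_exp hc).comp continuous_snd).prodMk
      ((continuous_exp hc).comp (continuous_snd.add continuous_fst))
  have hcont := (continuous_hdist hc).comp h1
  simp only [Function.comp_def] at hcont
  -- At displacement `w = 0` the distance vanishes for every `u`; compactness of `C` gives one
  -- neighbourhood of 0 valid for all `u`.
  have hev := hC.eventually_forall_of_forall_eventually (x₀ := (0 : EuclideanSpace ℝ (Fin n)))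
    (P := fun w u => hdist (Exp (origin c n) u) (Exp (origin c n) (u + w)) < ε)
    fun u _ => (hcont.tendsto (0, u)).eventually_lt_const (by simpa [hdist_self hc] using hε)
  obtain ⟨δ, hδ, h⟩ := Metric.eventually_nhds_iff.1 hev
  refine ⟨δ, hδ, fun u hu v huv => ?_⟩
  have := h (y := v - u) (by simpa using huv) u hu
  rwa [add_sub_cancel] at this

end PoincareBall

end HyperbolicTopology

end

/-! ### Transfer to the hyperbolic spaces -/

theorem mainTheorem7 (σ : ℝ → ℝ) (hσ_cont : Continuous σ) (hσ_poly : ¬ IsPolynomialFun σ)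
    (hσ_bdd : LocallyBoundedFun σ) (c : ℝ) (hc : 0 < c) (m n : ℕ)
    (g : C(PoincareBall c m, PoincareBall c n)) (ε : ℝ) (hε : 0 < ε)
    (K : Set (PoincareBall c m)) (hK : IsCompact K) :
    ∃ h ∈ HyperbolicFeedForward σ c m n,
      BddAbove ((fun x => PoincareBall.hdist (g x) (h x)) '' K) ∧
        sSup ((fun x => PoincareBall.hdist (g x) (h x)) '' K) < ε := by
  let E := PoincareBall.Exp (PoincareBall.origin c m)
  let L := PoincareBall.Log (PoincareBall.origin c m)
  let E' := PoincareBall.Exp (PoincareBall.origin c n)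
  let L' := PoincareBall.Log (PoincareBall.origin c n)
  have hE : Continuous E := PoincareBall.continuous_exp hc
  have hL : Continuous L := PoincareBall.continuous_log hc
  have hE' : Continuous E' := PoincareBall.continuous_exp hc
  have hL' : Continuous L' := PoincareBall.continuous_log hc
  have hG : Continuous fun v => L' (g (E v)) := hL'.comp (g.continuous.comp hE)
  have hLK : IsCompact (L '' K) := hK.image hL
  obtain ⟨δ, hδ, hEδ⟩ := PoincareBall.exists_forall_hdist_exp_lt hc (hLK.image hG) (half_pos hε)
  obtain ⟨F, hF, hFc, hFG⟩ := exists_feedForward_near hσ_cont hσ_poly hLK hG hδ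
  have hbound : ∀ x ∈ K, PoincareBall.hdist (g x) (E' (F (L x))) < ε / 2 := by
    intro x hx
    have h := hEδ _ (Set.mem_image_of_mem _ (Set.mem_image_of_mem _ hx)) _
      (hFG _ (Set.mem_image_of_mem _ hx))
    simpa only [L, E, L', E', PoincareBall.exp_log hc] using h
  refine ⟨⟨fun x => E' (F (L x)), hE'.comp (hFc.comp hL)⟩, ⟨F, hF, fun x => rfl⟩, ?_, ?_⟩
  · refine ⟨ε / 2, ?_⟩
    rintro _ ⟨x, hx, rfl⟩
    exact (hbound x hx).le
  -- Working with `ε / 2` keeps the supremum strictly below `ε`; its nonnegativity covers empty `K`,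
  -- where `sSup ∅ = 0`.
  · refine (Real.sSup_le ?_ (half_pos hε).le).trans_lt (half_lt_self hε)
    rintro _ ⟨x, hx, rfl⟩
    exact (hbound x hx).le
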